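/- Let $X$ be a random vector in $\mathbb{R}^d$ with mean $\mu = \mathbb{E}[X]$, let $X_1, X_2, \dots$ be i.i.d. samples of $X$, and put $S_0 = 0$, $S_n = X_1 + \dots + X_n$. Let $0 \le N_0 < N_1 < N_2 < \cdots$ be integers, $\mathscr{N} = \{N_1, N_2, \dots\}$, let $\mathscr{R} \subseteq [0,\infty) \times \mathbb{R}^d$ (the continuity region) have closure $\overline{\mathscr{R}}$, and define the exit time $$\boldsymbol{N} = \inf\{ n \in \mathscr{N} : (n, S_n) \notin \mathscr{R} \} \in \mathscr{N} \cup \{\infty\} \qquad (\inf \emptyset = \infty).$$ Assume: (I) there are real numbers $\lambda > 0$ and $K$ such that $N_{\ell+1} \le \lambda N_\ell + K$ for all $\ell \ge 0$; (II) either $\limsup_{\ell\to\infty} (N_{\ell+1} - N_\ell) < \infty$ or $\liminf_{\ell\to\infty} N_{\ell+1}/N_\ell > 1$; (III) $\overline{\mathscr{R}}$ is a convex set containing $(0, \boldsymbol{0}_d)$; (IV) $(N_0, S_{N_0}) \in \overline{\mathscr{R}}$ with probability one; (V) there is a unique positive number $m$ such that $(m, m\mu)$ belongs to the boundary of $\overline{\mathscr{R}}$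 in $\mathbb{R} \times \mathbb{R}^d$; (VI) $\mathbb{E}[|x_j|^3] < \infty$ for each coordinate $x_j$ of $X$. Then $\mathbb{E}[\boldsymbol{N}] < \infty$. -/

import Mathlib

open MeasureTheory ProbabilityTheory Filter
open scoped ENNReal

/-- The partial sum `S_n = X_1 + ⋯ + X_n`, where `Xs i` is the sample `X_{i+1}`; `S_0 = 0`. -/
noncomputable def partialSum {Ω : Type*} {d : ℕ} (Xs : ℕ → Ω → (Fin d → ℝ)) (n : ℕ) (ω : Ω) :
    Fin d → ℝ :=
  ∑ i ∈ Finset.range n, Xs i ω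

/-- The exit time `inf {n ∈ {N_1, N_2, …} : (n, S_n) ∉ R}` of the random walk from the
continuity region `R`; it is `⊤` if the walk is in `R` at all the times `N_1, N_2, …`. -/
noncomputable def exitTime {Ω : Type*} {d : ℕ} (N : ℕ → ℕ) (R : Set (ℝ × (Fin d → ℝ)))
    (Xs : ℕ → Ω → (Fin d → ℝ)) (ω : Ω) : ℕ∞ :=
  sInf {t : ℕ∞ | ∃ ℓ : ℕ, 1 ≤ ℓ ∧ ((N ℓ : ℝ), partialSum Xs (N ℓ) ω) ∉ R ∧ t = (N ℓ : ℕ∞)}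

/-- The mean vector `E[X]`, coordinate by coordinate. -/
noncomputable def meanVec {Ω : Type*} [MeasurableSpace Ω] {d : ℕ} (P : Measure Ω)
    (X : Ω → (Fin d → ℝ)) : Fin d → ℝ :=
  fun j => ∫ ω, X ω j ∂P

/-! By convexity the ray through `(1, μ)` leaves the closed region, so Hahn–Banach gives a
functional `g` and a level `u` with `g < u` on the region and `g > u` at a point of the ray. As the
origin lies in the region, `u > 0`, whence `g (1, μ) > 0`. Then `g (n, S_n)` is a real random walk
with positive drift, and it is below `u` whenever the walk is in the region. Third moments make this
event have probability `O(n^{-3/2})` (`exists_eventually_measureReal_sum_lt_le`). The exit time is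
at most `N_1` plus the gaps that follow such events (`exitTime_le_add_tsum`), and the expected gaps
are summable under either growth condition (`summable_gap_mul`). -/

/-- A first-order expansion of `|·|³` at `x`: the linear term has mean zero once `y` is centred and
independent of `x`. -/
lemma abs_add_pow_three_le (x y : ℝ) :
    |x + y| ^ 3 ≤ |x| ^ 3 + 3 * (|x| * x) * y + 3 * |x| * y ^ 2 + |y| ^ 3 := by
  rcases abs_cases (x + y) with ⟨h, h'⟩ | ⟨h, h'⟩ <;> rcases abs_cases x with ⟨hx, hx'⟩ | ⟨hx, hx'⟩ <;>
    rcases abs_cases y with ⟨hy, hy'⟩ | ⟨hy, hy'⟩ <;> rw [h, hx, hy]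
  · nlinarith [mul_nonneg hx' hy', mul_nonneg hx' (sq_nonneg y)]
  · nlinarith [pow_pos (neg_pos.2 hy') 3]
  · nlinarith [mul_nonneg (neg_pos.2 hx').le (sq_nonneg (x + 3 / 2 * y)),
      mul_nonneg (neg_pos.2 hx').le (sq_nonneg y)]
  · linarith
  · linarith
  · nlinarith [mul_nonneg hx' (sq_nonneg (x + 3 / 2 * y)), mul_nonneg hx' (sq_nonneg y)]
  · nlinarith [pow_nonneg hy' 3]
  · nlinarith

section Moments

variable {Ω : Type*} [MeasurableSpace Ω] {P : Measure Ω}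

lemma MeasureTheory.MemLp.integrable_abs_pow_three {f : Ω → ℝ} (hf : MemLp f 3 P) :
    Integrable (fun ω => |f ω| ^ 3) P := by
  simpa using hf.integrable_norm_pow (p := 3) (by norm_num)

lemma MeasureTheory.MemLp.sum_range {Z : ℕ → Ω → ℝ} (hZ : ∀ i, MemLp (Z i) 3 P) (n : ℕ) :
    MemLp (fun ω => ∑ i ∈ Finset.range n, Z i ω) 3 P :=
  memLp_finsetSum _ fun i _ => hZ i

variable [IsProbabilityMeasure P]

lemma MeasureTheory.MemLp.memLp_two_of_three {f : Ω → ℝ} (hf : MemLp f 3 P) : MemLp f 2 P :=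
  hf.mono_exponent (by norm_num)

lemma MeasureTheory.MemLp.integrable_of_three {f : Ω → ℝ} (hf : MemLp f 3 P) : Integrable f P :=
  hf.integrable (by norm_num)

/-- Adding an independent centred variable changes the third absolute moment by at most
`3 E|S| E[Z²] + E|Z|³`. -/
lemma integral_abs_add_pow_three_le {S Z : Ω → ℝ} (hS : MemLp S 3 P) (hZ : MemLp Z 3 P)
    (hind : IndepFun S Z P) (hZ0 : ∫ ω, Z ω ∂P = 0) :
    ∫ ω, |S ω + Z ω| ^ 3 ∂P ≤ ∫ ω, |S ω| ^ 3 ∂P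
      + 3 * (∫ ω, |S ω| ∂P) * (∫ ω, Z ω ^ 2 ∂P) + ∫ ω, |Z ω| ^ 3 ∂P := by
  have iS2 : Integrable (fun ω => |S ω| * S ω) P :=
    (hS.memLp_two_of_three.abs).integrable_mul hS.memLp_two_of_three
  have i1 : IndepFun (fun ω => |S ω| * S ω) Z P :=
    hind.comp (φ := fun x : ℝ => |x| * x) (ψ := id) (by fun_prop) measurable_id
  have i2 : IndepFun (fun ω => |S ω|) (fun ω => Z ω ^ 2) P :=
    hind.comp (φ := fun x : ℝ => |x|) (ψ := fun x : ℝ => x ^ 2) (by fun_prop) (by fun_prop)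
  have iZ2 : Integrable (fun ω => Z ω ^ 2) P := hZ.memLp_two_of_three.integrable_sq
  have iS : Integrable (fun ω => |S ω|) P := hS.integrable_of_three.abs
  have j1 : Integrable (fun ω => (|S ω| * S ω) * Z ω) P :=
    i1.integrable_mul iS2 hZ.integrable_of_three
  have j2 : Integrable (fun ω => |S ω| * Z ω ^ 2) P := i2.integrable_mul iS iZ2
  have e1 : ∫ ω, (|S ω| * S ω) * Z ω ∂P = 0 := by
    rw [i1.integral_fun_mul_eq_mul_integral iS2.aestronglyMeasurable
      hZ.aestronglyMeasurable, hZ0, mul_zero]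
  have e2 : ∫ ω, |S ω| * Z ω ^ 2 ∂P = (∫ ω, |S ω| ∂P) * ∫ ω, Z ω ^ 2 ∂P :=
    i2.integral_fun_mul_eq_mul_integral iS.aestronglyMeasurable iZ2.aestronglyMeasurable
  have k0 := hS.integrable_abs_pow_three
  have k1 : Integrable (fun ω => 3 * ((|S ω| * S ω) * Z ω)) P := j1.const_mul 3
  have k2 : Integrable (fun ω => 3 * (|S ω| * Z ω ^ 2)) P := j2.const_mul 3
  have k3 := hZ.integrable_abs_pow_three
  have k01 : Integrable (fun ω => |S ω| ^ 3 + 3 * ((|S ω| * S ω) * Z ω)) P := k0.add k1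
  have k012 : Integrable (fun ω => |S ω| ^ 3 + 3 * ((|S ω| * S ω) * Z ω)
    + 3 * (|S ω| * Z ω ^ 2)) P := k01.add k2
  calc ∫ ω, |S ω + Z ω| ^ 3 ∂P
      ≤ ∫ ω, (|S ω| ^ 3 + 3 * ((|S ω| * S ω) * Z ω) + 3 * (|S ω| * Z ω ^ 2) + |Z ω| ^ 3) ∂P := by
        refine integral_mono (hS.add hZ).integrable_abs_pow_three
          (k012.add k3) fun ω => ?_
        have := abs_add_pow_three_le (S ω) (Z ω)
        simp only
        linarith
    _ = _ := by
        rw [integral_add k012 k3, integral_add k01 k2,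
          integral_add k0 k1, integral_const_mul, integral_const_mul, e1, e2]
        ring

lemma integral_sum_sq_eq {Z : ℕ → Ω → ℝ} (hZ : ∀ i, MemLp (Z i) 3 P) (hind : iIndepFun Z P)
    (h0 : ∀ i, ∫ ω, Z i ω ∂P = 0) {v : ℝ} (hv : ∀ i, ∫ ω, Z i ω ^ 2 ∂P = v) (n : ℕ) :
    ∫ ω, (∑ i ∈ Finset.range n, Z i ω) ^ 2 ∂P = n * v := by
  have hs0 : ∫ ω, (∑ i ∈ Finset.range n, Z i) ω ∂P = 0 := by
    simp only [Finset.sum_apply]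
    rw [integral_finsetSum _ fun i _ => (hZ i).integrable_of_three]
    simp [h0]
  have h := IndepFun.variance_sum (μ := P) (X := Z) (s := Finset.range n)
    (fun i _ => (hZ i).memLp_two_of_three) (fun i _ j _ hij => hind.indepFun hij)
  rw [variance_of_integral_eq_zero (Finset.aemeasurable_sum _ fun i _ =>
    (hZ i).aestronglyMeasurable.aemeasurable) hs0] at h
  simp only [Finset.sum_apply] at h
  rw [h, Finset.sum_congr rfl fun i _ => (variance_of_integral_eq_zero
    (hZ i).aestronglyMeasurable.aemeasurable (h0 i)).trans (hv i)]
  simp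

lemma integral_abs_sum_le {Z : ℕ → Ω → ℝ} (hZ : ∀ i, MemLp (Z i) 3 P) (hind : iIndepFun Z P)
    (h0 : ∀ i, ∫ ω, Z i ω ∂P = 0) {v : ℝ} (hv : ∀ i, ∫ ω, Z i ω ^ 2 ∂P = v) (n : ℕ) :
    ∫ ω, |∑ i ∈ Finset.range n, Z i ω| ∂P ≤ √n * (1 + v) := by
  rcases Nat.eq_zero_or_pos n with rfl | hn
  · simp
  have hn' : 0 < √(n : ℝ) := Real.sqrt_pos.2 (by exact_mod_cast hn)
  have hsq : √(n : ℝ) * √(n : ℝ) = n := Real.mul_self_sqrt (by positivity)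
  have hm := MemLp.sum_range hZ n
  have hi := hm.memLp_two_of_three.integrable_sq
  -- The bound `√n |S| ≤ n + S²` replaces Cauchy–Schwarz.
  have key : ∫ ω, √(n : ℝ) * |∑ i ∈ Finset.range n, Z i ω| ∂P ≤
      ∫ ω, ((n : ℝ) + (∑ i ∈ Finset.range n, Z i ω) ^ 2) ∂P := by
    refine integral_mono (hm.integrable_of_three.abs.const_mul _)
      ((integrable_const _).add hi) fun ω => ?_
    simp only
    rw [← sq_abs (∑ i ∈ Finset.range n, Z i ω)]
    nlinarith [sq_nonneg (√(n : ℝ) - |∑ i ∈ Finset.range n, Z i ω|),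
      sq_nonneg (√(n : ℝ) + |∑ i ∈ Finset.range n, Z i ω|)]
  rw [integral_const_mul, integral_add (integrable_const _) hi,
    integral_sum_sq_eq hZ hind h0 hv] at key
  simp only [integral_const, probReal_univ, one_smul] at key
  refine le_of_mul_le_mul_left (key.trans (le_of_eq ?_)) hn'
  rw [← mul_assoc, hsq]; ring

/-- The third absolute moment of a centred random walk is `O(n^{3/2})`. -/
lemma exists_integral_abs_sum_pow_three_le {Z : ℕ → Ω → ℝ} (hZ : ∀ i, MemLp (Z i) 3 P)
    (hind : iIndepFun Z P) (h0 : ∀ i, ∫ ω, Z i ω ∂P = 0) {v ρ : ℝ}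
    (hv : ∀ i, ∫ ω, Z i ω ^ 2 ∂P = v) (hρ : ∀ i, ∫ ω, |Z i ω| ^ 3 ∂P = ρ) :
    ∃ M : ℝ, 0 ≤ M ∧ ∀ n : ℕ,
      ∫ ω, |∑ i ∈ Finset.range n, Z i ω| ^ 3 ∂P ≤ M * (n * √n) := by
  have hv0 : 0 ≤ v := hv 0 ▸ integral_nonneg fun _ => sq_nonneg _
  have hρ0 : 0 ≤ ρ := hρ 0 ▸ integral_nonneg fun _ => by positivity
  -- One step adds at most `3 √n (1 + v) v + ρ ≤ M √(n+1)`.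
  refine ⟨3 * (1 + v) * v + ρ, by positivity, fun n => ?_⟩
  induction n with
  | zero => simp
  | succ n ih =>
    have hin : IndepFun (fun ω => ∑ i ∈ Finset.range n, Z i ω) (Z n) P := by
      have := hind.indepFun_finsetSum_of_notMem₀
        (fun i => (hZ i).aestronglyMeasurable.aemeasurable) (Finset.notMem_range_self (n := n))
      convert this using 1
      ext ω; simp
    have step := integral_abs_add_pow_three_le (MemLp.sum_range hZ n) (hZ n) hin (h0 n)
    rw [hv, hρ] at step
    simp only [Finset.sum_range_succ]
    have hE := mul_le_mul_of_nonneg_right (integral_abs_sum_le hZ hind h0 hv n) hv0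
    have h1 : √(n : ℝ) ≤ √((n + 1 : ℕ) : ℝ) := Real.sqrt_le_sqrt (by push_cast; linarith)
    have h2 : 1 ≤ √((n + 1 : ℕ) : ℝ) := Real.one_le_sqrt.2 (by push_cast; linarith [n.cast_nonneg (α := ℝ)])
    have h3 : √(n : ℝ) * (3 * (1 + v) * v) ≤ √((n + 1 : ℕ) : ℝ) * (3 * (1 + v) * v) :=
      mul_le_mul_of_nonneg_right h1 (by positivity)
    have h4 : 1 * ρ ≤ √((n + 1 : ℕ) : ℝ) * ρ := mul_le_mul_of_nonneg_right h2 hρ0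
    have h5 : (3 * (1 + v) * v + ρ) * (n * √n) ≤
        (3 * (1 + v) * v + ρ) * (n * √((n + 1 : ℕ) : ℝ)) := by gcongr
    have h6 : (3 * (1 + v) * v + ρ) * (((n + 1 : ℕ) : ℝ) * √((n + 1 : ℕ) : ℝ)) =
        (3 * (1 + v) * v + ρ) * (n * √((n + 1 : ℕ) : ℝ))
          + (√((n + 1 : ℕ) : ℝ) * (3 * (1 + v) * v) + √((n + 1 : ℕ) : ℝ) * ρ) := by
      have : ((n + 1 : ℕ) : ℝ) = n + 1 := by push_cast; rfl
      generalize √((n + 1 : ℕ) : ℝ) = r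
      rw [this]; ring
    rw [h6]
    linarith

/-- A random walk with positive drift and finite third moment is below a fixed level at time `n`
with probability `O(n^{-3/2})`. -/
lemma exists_eventually_measureReal_sum_lt_le {Y : ℕ → Ω → ℝ} {Y₀ : Ω → ℝ} (hY₀ : MemLp Y₀ 3 P)
    (hid : ∀ i, IdentDistrib (Y i) Y₀ P P) (hind : iIndepFun Y P) (hpos : 0 < ∫ ω, Y₀ ω ∂P)
    (u : ℝ) :
    ∃ C : ℝ, 0 ≤ C ∧ ∀ᶠ n : ℕ in atTop,
      P.real {ω | ∑ i ∈ Finset.range n, Y i ω < u} ≤ C / (n * √n) := by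
  set c := ∫ ω, Y₀ ω ∂P with hc
  have hidZ : ∀ i, IdentDistrib (fun ω => Y i ω - c) (fun ω => Y₀ ω - c) P P := fun i =>
    (hid i).comp (u := fun x : ℝ => x - c) (by fun_prop)
  have hZ₀ : MemLp (fun ω => Y₀ ω - c) 3 P := hY₀.sub (memLp_const c)
  have hZ : ∀ i, MemLp (fun ω => Y i ω - c) 3 P := fun i => (hidZ i).memLp_iff.2 hZ₀
  have hindZ : iIndepFun (fun i ω => Y i ω - c) P :=
    hind.comp (fun _ x => x - c) (fun _ => by fun_prop)
  have h0 : ∀ i, ∫ ω, (Y i ω - c) ∂P = 0 := fun i => by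
    rw [(hidZ i).integral_eq, integral_sub hY₀.integrable_of_three (integrable_const c)]
    simp [hc]
  obtain ⟨M, hM, hb⟩ := exists_integral_abs_sum_pow_three_le hZ hindZ h0
    (v := ∫ ω, (Y₀ ω - c) ^ 2 ∂P) (ρ := ∫ ω, |Y₀ ω - c| ^ 3 ∂P)
    (fun i => ((hidZ i).comp (u := fun x : ℝ => x ^ 2) (by fun_prop)).integral_eq)
    (fun i => ((hidZ i).comp (u := fun x : ℝ => |x| ^ 3) (by fun_prop)).integral_eq)
  -- Markov's inequality for the cube at level `(nc/2)³`; once `n ≥ 2u/c`, falling below `u` means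
  -- deviating from the mean `nc` by at least `nc/2`.
  refine ⟨8 * M / c ^ 3, by positivity, ?_⟩
  filter_upwards [eventually_ge_atTop (max 1 ⌈2 * u / c⌉₊)] with n hn
  have hn1 : 1 ≤ n := (le_max_left _ _).trans hn
  have hn0 : (0 : ℝ) < n := by exact_mod_cast hn1
  have hnu : 2 * u / c ≤ n := (Nat.le_ceil _).trans (by exact_mod_cast (le_max_right _ _).trans hn)
  rw [div_le_iff₀ hpos] at hnu
  have hsub : {ω | ∑ i ∈ Finset.range n, Y i ω < u} ⊆
      {ω | (n * c / 2) ^ 3 ≤ |∑ i ∈ Finset.range n, (Y i ω - c)| ^ 3} := by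
    intro ω hω
    simp only [Set.mem_ofPred_eq, Finset.sum_sub_distrib, Finset.sum_const, Finset.card_range,
      nsmul_eq_mul] at hω ⊢
    refine pow_le_pow_left₀ (by positivity) (le_abs.2 (Or.inr ?_)) 3
    linarith
  have hmark := mul_meas_ge_le_integral_of_nonneg (μ := P)
    (ae_of_all _ fun ω => by positivity) ((MemLp.sum_range hZ n).integrable_abs_pow_three)
    ((n * c / 2) ^ 3)
  have hle := measureReal_mono (μ := P) hsub
  have hsq : √(n : ℝ) * √(n : ℝ) = n := Real.mul_self_sqrt hn0.le
  have hs0 : 0 < √(n : ℝ) := Real.sqrt_pos.2 hn0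
  have h3 : (0 : ℝ) < (n * c / 2) ^ 3 := by positivity
  refine hle.trans (((le_div_iff₀' h3).2 (hmark.trans (hb n))).trans (le_of_eq ?_))
  rw [div_div, div_eq_div_iff h3.ne' (by positivity)]
  linear_combination (M * n ^ 2 * c ^ 3) * hsq

lemma ContinuousLinearMap.apply_prodMk_one {E : Type*} [NormedAddCommGroup E] [NormedSpace ℝ E]
    (g : ℝ × E →L[ℝ] ℝ) (x : E) : g (1, x) = g (1, 0) + g.comp (.inr ℝ ℝ E) x := by
  simp [← map_add]

lemma ContinuousLinearMap.memLp_apply_prodMk_one {E : Type*} [NormedAddCommGroup E]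
    [NormedSpace ℝ E] (g : ℝ × E →L[ℝ] ℝ) {X : Ω → E} {r : ℝ≥0∞} (hX : MemLp X r P) :
    MemLp (fun ω => g (1, X ω)) r P := by
  have h := (memLp_const (μ := P) (p := r) (g (1, 0))).add
    ((g.comp (.inr ℝ ℝ E)).comp_memLp' hX)
  convert h using 1
  ext ω
  exact g.apply_prodMk_one (X ω)

lemma ContinuousLinearMap.integral_apply_prodMk_one {E : Type*} [NormedAddCommGroup E]
    [NormedSpace ℝ E] [CompleteSpace E] (g : ℝ × E →L[ℝ] ℝ) {X : Ω → E} (hX : Integrable X P) :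
    ∫ ω, g (1, X ω) ∂P = g (1, ∫ ω, X ω ∂P) := by
  rw [g.apply_prodMk_one (∫ ω, X ω ∂P), ← ContinuousLinearMap.integral_comp_comm _ hX,
    integral_congr_ae (ae_of_all _ fun ω => g.apply_prodMk_one (X ω)),
    integral_add (integrable_const _) (ContinuousLinearMap.integrable_comp _ hX)]
  simp

end Moments

/-- Convexity of a closed region forces the ray to leave it if it meets the boundary exactly once
at positive time. -/
lemma exists_pos_smul_notMem {E : Type*} [NormedAddCommGroup E] [NormedSpace ℝ E] {C : Set E}
    (hC : IsClosed C) (hconv : Convex ℝ C) {w : E}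
    (h : ∃! m : ℝ, 0 < m ∧ m • w ∈ frontier C) : ∃ s : ℝ, 0 < s ∧ s • w ∉ C := by
  by_contra! hall
  obtain ⟨m, ⟨hm, hmf⟩, huniq⟩ := h
  have hint : ∀ s : ℝ, 0 < s → s ≠ m → s • w ∈ interior C := fun s hs hsm => by
    by_contra hni
    exact hsm (huniq s ⟨hs, by rw [hC.frontier_eq]; exact ⟨hall s hs, hni⟩⟩)
  -- The boundary point at `m` is the midpoint of two interior points.
  have h1 := hint (m / 2) (by linarith) (by linarith)
  have h2 := hint (3 * m / 2) (by linarith) (by linarith)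
  have h3 := hconv.interior h1 h2 (a := 1 / 2) (b := 1 / 2) (by norm_num) (by norm_num)
    (by norm_num)
  rw [smul_smul, smul_smul, ← add_smul, show 1 / 2 * (m / 2) + 1 / 2 * (3 * m / 2) = m by ring]
    at h3
  exact hmf.2 h3

/-- If the sample sizes have bounded gaps or grow geometrically, then the gaps are summable
against any weights that are `O(n^{-3/2})` at time `n`. -/
lemma summable_gap_mul {N : ℕ → ℕ} (hN : StrictMono N)
    (h1 : ∃ lam K : ℝ, 0 < lam ∧ ∀ ℓ : ℕ, (N (ℓ + 1) : ℝ) ≤ lam * (N ℓ : ℝ) + K)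
    (h2 : limsup (fun ℓ : ℕ => (((N (ℓ + 1) : ℝ) - (N ℓ : ℝ) : ℝ) : EReal)) atTop < ⊤ ∨
      1 < liminf (fun ℓ : ℕ => (((N (ℓ + 1) : ℝ) / (N ℓ : ℝ) : ℝ) : EReal)) atTop)
    {p : ℕ → ℝ} (hp0 : ∀ n, 0 ≤ p n) {C : ℝ} (hC : 0 ≤ C)
    (hp : ∀ᶠ n : ℕ in atTop, p n ≤ C / (n * √n)) :
    Summable fun ℓ => ((N (ℓ + 1) : ℝ) - N ℓ) * p (N ℓ) := by
  have hgap : ∀ ℓ, (0 : ℝ) ≤ (N (ℓ + 1) : ℝ) - N ℓ := fun ℓ =>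
    sub_nonneg.2 (by exact_mod_cast (hN (Nat.lt_succ_self ℓ)).le)
  have hpN := hN.tendsto_atTop.eventually hp
  rcases h2 with h2 | h2
  · obtain ⟨B, hB, -⟩ := EReal.lt_iff_exists_real_btwn.1 h2
    have hev := eventually_lt_of_limsup_lt hB
    have hsum : Summable fun n : ℕ => B * C * (1 / (n : ℝ) ^ (3 / 2 : ℝ)) :=
      (Real.summable_one_div_nat_rpow.2 (by norm_num)).mul_left _
    refine Summable.of_norm_bounded_eventually_nat hsum ?_
    filter_upwards [hev, hpN, eventually_ge_atTop 1] with ℓ hℓ hpℓ h1ℓ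
    have hℓ' : (N (ℓ + 1) : ℝ) - N ℓ < B := EReal.coe_lt_coe_iff.1 hℓ
    have hNℓ : (ℓ : ℝ) ≤ N ℓ := by exact_mod_cast hN.le_apply
    have hℓ0 : (0 : ℝ) < ℓ := by exact_mod_cast h1ℓ
    have hpow : (ℓ : ℝ) ^ (3 / 2 : ℝ) = ℓ * √ℓ := by
      rw [Real.sqrt_eq_rpow, show (3 / 2 : ℝ) = 1 + 1 / 2 by norm_num, Real.rpow_add hℓ0,
        Real.rpow_one]
    rw [Real.norm_of_nonneg (mul_nonneg (hgap ℓ) (hp0 _)), hpow, mul_assoc, mul_one_div]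
    have hs0 : 0 < √(ℓ : ℝ) := Real.sqrt_pos.2 hℓ0
    refine mul_le_mul hℓ'.le (hpℓ.trans ?_) (hp0 _) ((hgap ℓ).trans hℓ'.le)
    gcongr
  · obtain ⟨lam, K, hlam, h1⟩ := h1
    obtain ⟨q, hq1, hq⟩ := EReal.lt_iff_exists_real_btwn.1 h2
    have hq1' : 1 < q := by exact_mod_cast hq1
    have hev := eventually_lt_of_lt_liminf hq
    have hq0 : 0 < q := by linarith
    -- A gap is `O(N ℓ)`, so the terms are `O(1/√(N ℓ))`, which decays geometrically with ratio
    -- `1/√q`.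
    have hsum : Summable fun ℓ : ℕ => (lam + |K|) * C * (1 / √(N ℓ : ℝ)) := by
      refine Summable.mul_left _ (summable_of_ratio_norm_eventually_le (r := 1 / √q) ?_ ?_)
      · rw [div_lt_one (Real.sqrt_pos.2 hq0)]
        exact Real.lt_sqrt_of_sq_lt (by simpa using hq1')
      · filter_upwards [hev, eventually_ge_atTop 1] with ℓ hℓ h1ℓ
        have hN0 : (0 : ℝ) < N ℓ := by exact_mod_cast h1ℓ.trans hN.le_apply
        have hℓ' : q < (N (ℓ + 1) : ℝ) / N ℓ := EReal.coe_lt_coe_iff.1 hℓ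
        rw [lt_div_iff₀ hN0] at hℓ'
        rw [Real.norm_of_nonneg (by positivity), Real.norm_of_nonneg (by positivity), div_mul_div_comm,
          one_mul, ← Real.sqrt_mul hq0.le]
        have : 0 < √(q * N ℓ) := Real.sqrt_pos.2 (by positivity)
        gcongr
    refine Summable.of_norm_bounded_eventually_nat hsum ?_
    filter_upwards [hpN, eventually_ge_atTop 1] with ℓ hpℓ h1ℓ
    have hN1 : (1 : ℝ) ≤ N ℓ := by exact_mod_cast h1ℓ.trans hN.le_apply
    have hN0 : (0 : ℝ) < N ℓ := by linarith
    have hs0 : 0 < √(N ℓ : ℝ) := Real.sqrt_pos.2 hN0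
    rw [Real.norm_of_nonneg (mul_nonneg (hgap ℓ) (hp0 _))]
    have hg : (N (ℓ + 1) : ℝ) - N ℓ ≤ (lam + |K|) * N ℓ := by
      have := h1 ℓ
      nlinarith [le_abs_self K, mul_nonneg (abs_nonneg K) (sub_nonneg.2 hN1)]
    calc _ ≤ ((lam + |K|) * N ℓ) * (C / (N ℓ * √(N ℓ))) :=
          mul_le_mul hg hpℓ (hp0 _) ((hgap ℓ).trans hg)
      _ = _ := by field_simp

/-- The exit time is at most `N_1` plus the gaps following the times at which the walk is in a
set containing the continuity region. -/
lemma exitTime_le_add_tsum {Ω : Type*} {d : ℕ} {N : ℕ → ℕ} (hN : StrictMono N)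
    {R : Set (ℝ × (Fin d → ℝ))} {Xs : ℕ → Ω → (Fin d → ℝ)} {A : ℕ → Set Ω}
    (hA : ∀ (n : ℕ) ω, ((n : ℝ), partialSum Xs n ω) ∈ R → ω ∈ A n) (ω : Ω) :
    (exitTime N R Xs ω : ℝ≥0∞) ≤
      N 1 + ∑' ℓ, (A (N ℓ)).indicator (fun _ => ((N (ℓ + 1) - N ℓ : ℕ) : ℝ≥0∞)) ω := by
  classical
  by_cases hex : ∃ k, 1 ≤ k ∧ ω ∉ A (N k)
  · set k := Nat.find hex with hk
    obtain ⟨hk1, hkA⟩ := Nat.find_spec hex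
    have hmin : ∀ j, 1 ≤ j → j < k → ω ∈ A (N j) := fun j hj hjk => by
      by_contra h
      exact Nat.find_min hex hjk ⟨hj, h⟩
    have hle : exitTime N R Xs ω ≤ (N k : ℕ∞) :=
      sInf_le ⟨k, hk1, fun h => hkA (hA _ _ h), rfl⟩
    have hle' : (exitTime N R Xs ω : ℝ≥0∞) ≤ N k := by
      have := ENat.toENNReal_le.2 hle
      simpa using this
    refine hle'.trans ?_
    have hsum : N k = N 1 + ∑ ℓ ∈ Finset.Ico 1 k, (N (ℓ + 1) - N ℓ) := by
      have key : ∀ j, 1 ≤ j → N j = N 1 + ∑ ℓ ∈ Finset.Ico 1 j, (N (ℓ + 1) - N ℓ) := by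
        intro j hj
        induction j, hj using Nat.le_induction with
        | base => simp
        | succ j hj ih =>
          rw [Finset.sum_Ico_succ_top hj, ← add_assoc, ← ih]
          have := hN (Nat.lt_succ_self j)
          simp only [Nat.succ_eq_add_one] at this
          omega
      exact key k hk1
    rw [hsum, Nat.cast_add, Nat.cast_sum]
    refine add_le_add le_rfl (le_trans (le_of_eq ?_) (ENNReal.sum_le_tsum (Finset.Ico 1 k)))
    refine Finset.sum_congr rfl fun ℓ hℓ => ?_
    rw [Finset.mem_Ico] at hℓ
    rw [Set.indicator_of_mem (hmin ℓ hℓ.1 hℓ.2)]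
  -- If the walk never leaves, every gap is at least `1` and the series diverges.
  · push Not at hex
    refine le_top.trans (le_of_eq ?_)
    symm
    rw [ENNReal.add_eq_top]
    right
    rw [eq_top_iff]
    calc (⊤ : ℝ≥0∞) = ∑' _ : ℕ, (1 : ℝ≥0∞) :=
          (ENNReal.tsum_const_eq_top_of_ne_zero one_ne_zero).symm
      _ ≤ ∑' ℓ, (A (N (ℓ + 1))).indicator
            (fun _ => ((N (ℓ + 1 + 1) - N (ℓ + 1) : ℕ) : ℝ≥0∞)) ω := by
          refine ENNReal.tsum_le_tsum fun ℓ => ?_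
          rw [Set.indicator_of_mem (hex _ (by omega))]
          have := hN (Nat.lt_succ_self (ℓ + 1))
          simp only [Nat.succ_eq_add_one] at this
          exact_mod_cast (by omega : 1 ≤ N (ℓ + 1 + 1) - N (ℓ + 1))
      _ ≤ _ := ENNReal.tsum_comp_le_tsum_of_injective (add_left_injective 1)
            (fun ℓ => (A (N ℓ)).indicator (fun _ => ((N (ℓ + 1) - N ℓ : ℕ) : ℝ≥0∞)) ω)

theorem theorem9 {Ω : Type*} [MeasurableSpace Ω] (P : Measure Ω) [IsProbabilityMeasure P]
    (d : ℕ)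
    -- the random vector `X` and its i.i.d. samples `X_1, X_2, …` (here `Xs 0, Xs 1, …`)
    (X : Ω → (Fin d → ℝ)) (Xs : ℕ → Ω → (Fin d → ℝ))
    (hident : ∀ i, IdentDistrib (Xs i) X P P)
    (hindep : iIndepFun Xs P)
    -- the sample sizes `0 ≤ N_0 < N_1 < ⋯`
    (N : ℕ → ℕ) (hN : StrictMono N)
    -- the continuity region, a subset of `[0, ∞) × ℝ^d`
    (R : Set (ℝ × (Fin d → ℝ))) (hR : ∀ p ∈ R, 0 ≤ p.1)
    -- growth of the sample sizes
    (h1 : ∃ lam K : ℝ, 0 < lam ∧ ∀ ℓ : ℕ, (N (ℓ + 1) : ℝ) ≤ lam * (N ℓ : ℝ) + K)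
    -- bounded gaps or geometric growth (limits taken in the extended reals)
    (h2 : limsup (fun ℓ : ℕ => (((N (ℓ + 1) : ℝ) - (N ℓ : ℝ) : ℝ) : EReal)) atTop < ⊤ ∨
      1 < liminf (fun ℓ : ℕ => (((N (ℓ + 1) : ℝ) / (N ℓ : ℝ) : ℝ) : EReal)) atTop)
    -- convex closure containing the origin
    (h3 : Convex ℝ (closure R) ∧ (0, 0) ∈ closure R)
    -- the walk is in the closed region at time `N_0`
    (h4 : ∀ᵐ ω ∂P, ((N 0 : ℝ), partialSum Xs (N 0) ω) ∈ closure R)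
    -- the ray through `(1, μ)` meets the boundary exactly once at positive time
    (h5 : ∃! m : ℝ, 0 < m ∧ (m, m • meanVec P X) ∈ frontier (closure R))
    -- finite third absolute moments
    (h6 : ∀ j : Fin d, Integrable (fun ω => |X ω j| ^ 3) P) :
    ∫⁻ ω, (exitTime N R Xs ω : ℝ≥0∞) ∂P < ∞ := by
  set w : ℝ × (Fin d → ℝ) := (1, meanVec P X) with hw
  have hsmul : ∀ s : ℝ, s • w = (s, s • meanVec P X) := fun s => by simp [hw]
  obtain ⟨s, hs, hsC⟩ := exists_pos_smul_notMem (w := w) isClosed_closure h3.1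
    (by simpa only [hsmul] using h5)
  obtain ⟨g, u, hgu, hu⟩ := geometric_hahn_banach_closed_point h3.1 isClosed_closure hsC
  have hg0 : 0 < u := by simpa [← Prod.zero_eq_mk] using hgu _ h3.2
  have hgw : 0 < g w := by
    rw [map_smul, smul_eq_mul] at hu
    exact pos_of_mul_pos_right (hg0.trans hu) hs.le
  have hXm : AEMeasurable X P := (hident 0).aemeasurable_snd
  have hX : MemLp X 3 P := by
    refine memLp_pi_iff.2 fun j => ?_
    have hj : AEStronglyMeasurable (fun ω => X ω j) P :=
      ((measurable_pi_apply j).comp_aemeasurable hXm).aestronglyMeasurable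
    refine (integrable_norm_rpow_iff hj (by norm_num) (by norm_num)).1 ?_
    simpa using h6 j
  have hXint : Integrable X P := hX.integrable (by norm_num)
  have hgc : Measurable fun x : Fin d → ℝ => g (1, x) :=
    (g.continuous.comp (by fun_prop)).measurable
  have hY₀ : MemLp (fun ω => g (1, X ω)) 3 P := g.memLp_apply_prodMk_one hX
  have hmean : ∫ ω, g (1, X ω) ∂P = g w := by
    have hX' : ∫ ω, X ω ∂P = meanVec P X := by
      ext j
      exact eval_integral (fun i => hXint.eval i) j
    rw [g.integral_apply_prodMk_one hXint, hX']
  have hid : ∀ i, IdentDistrib (fun ω => g (1, Xs i ω)) (fun ω => g (1, X ω)) P P := fun i =>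
    (hident i).comp hgc
  have hind : iIndepFun (fun i ω => g (1, Xs i ω)) P := hindep.comp _ fun _ => hgc
  obtain ⟨C, hC, hev⟩ := exists_eventually_measureReal_sum_lt_le hY₀ hid hind
    (hmean ▸ hgw) u
  set A : ℕ → Set Ω := fun n => {ω | ∑ i ∈ Finset.range n, g (1, Xs i ω) < u} with hA
  have hsumm := summable_gap_mul hN h1 h2 (p := fun n => P.real (A n))
    (fun n => measureReal_nonneg) hC hev
  have hmem : ∀ (n : ℕ) ω, ((n : ℝ), partialSum Xs n ω) ∈ R → ω ∈ A n := fun n ω h => by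
    have h' := hgu _ (subset_closure h)
    -- Space-time steps `(1, X_i)` turn `g (n, S_n)` into an i.i.d. sum.
    have e : ((n : ℝ), partialSum Xs n ω) = ∑ i ∈ Finset.range n, ((1 : ℝ), Xs i ω) := by
      ext <;> simp [partialSum, Prod.fst_sum, Prod.snd_sum]
    rwa [e, map_sum] at h'
  have hAm : ∀ n, NullMeasurableSet (A n) P := fun n =>
    nullMeasurableSet_lt (Finset.aemeasurable_fun_sum _ fun i _ => (hid i).aemeasurable_fst)
      aemeasurable_const
  calc ∫⁻ ω, (exitTime N R Xs ω : ℝ≥0∞) ∂P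
      ≤ ∫⁻ ω, (N 1 + ∑' ℓ, (A (N ℓ)).indicator
          (fun _ => ((N (ℓ + 1) - N ℓ : ℕ) : ℝ≥0∞)) ω) ∂P :=
        lintegral_mono fun ω => exitTime_le_add_tsum hN hmem ω
    _ = N 1 + ∑' ℓ, ((N (ℓ + 1) - N ℓ : ℕ) : ℝ≥0∞) * P (A (N ℓ)) := by
        rw [lintegral_add_left measurable_const, lintegral_const, measure_univ, mul_one,
          lintegral_tsum fun ℓ => aemeasurable_const.indicator₀ (hAm _)]
        simp only [lintegral_indicator_const₀ (hAm _)]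
    _ = N 1 + ∑' ℓ, ENNReal.ofReal (((N (ℓ + 1) : ℝ) - N ℓ) * P.real (A (N ℓ))) := by
        congr 2
        ext ℓ
        have hle : N ℓ ≤ N (ℓ + 1) := (hN (Nat.lt_succ_self ℓ)).le
        rw [← Nat.cast_sub hle, ENNReal.ofReal_mul (by positivity), ENNReal.ofReal_natCast,
          ofReal_measureReal]
    _ < ∞ := ENNReal.add_lt_top.2 ⟨ENNReal.natCast_lt_top _, hsumm.tsum_ofReal_lt_top⟩
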